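/- Let $\mathbb{D}=\{z\in\mathbb{C}:|z|<1\}$ and $\mathbb{T}=\partial\mathbb{D}$. A majorant is a continuous increasing (i.e. non-decreasing) function $\omega:[0,\infty)\to[0,\infty)$, not identically zero, with $\omega(0)=0$ and such that $\omega(t)/t$ is non-increasing on $(0,\infty)$. For a set $\Omega\subset\mathbb{C}$, a function $f:\Omega\to\mathbb{C}$ belongs to $\mathscr{L}_\omega(\Omega)$ if there is a constant $M>0$ with $|f(z_1)-f(z_2)|\le M\,\omega(|z_1-z_2|)$ for all $z_1,z_2\in\Omega$. Let $\omega$ be any majorant, let $g\in C(\overline{\mathbb{D}})$ be complex-valued, let $\varphi:\mathbb{T}\to\mathbb{C}$, and put $\varphi_1(e^{it})=\varphi(e^{it})e^{-it}$ for $t\in[0,2\pi]$. Suppose that $\varphi_1\in\mathscr{L}_\omega(\mathbb{T})$ and that $f\in C^4(\mathbb{D})$ (complex-valued, in the real sense) satisfies $$\Delta(\Delta f)=g\ \text{ in }\mathbb{D},\qquad \partial_{\overline z}f=\varphi\ \text{ on }\mathbb{T},\qquad f=0\ \text{ on }\mathbb{T},$$ where $\Delta=\partial_x^2+\partial_y^2$,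 $\partial_{\overline z}=\frac12(\partial_x+i\,\partial_y)$, and the boundary conditions mean that $\partial_{\overline z}f(z)\to\varphi(\zeta)$ and $f(z)\to0$ as $z\to\zeta$, $z\in\mathbb{D}$, for every $\zeta\in\mathbb{T}$. Then $f\in\mathscr{L}_\omega(\mathbb{D})$. -/

import Mathlib

open scoped NNReal Topology ComplexConjugate

/-- A majorant: a continuous increasing function `ω : [0, ∞) → [0, ∞)` with `ω 0 = 0`, not
identically zero, such that `t ↦ ω t / t` is non-increasing on `(0, ∞)`. (Increasing is meant in
the weak sense, so that bounded majorants such as `t ↦ min t 1` are included.) -/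
structure IsMajorant (ω : ℝ≥0 → ℝ≥0) : Prop where
  continuous : Continuous ω
  monotone : Monotone ω
  map_zero : ω 0 = 0
  exists_ne_zero : ∃ t, ω t ≠ 0
  antitoneOn_div : AntitoneOn (fun t => ω t / t) (Set.Ioi 0)

/-- `f` belongs to the Lipschitz space `𝓛_ω(Ω)`, where `Ω` is a subset of the complex plane. Only
the values of `f` on `Ω` matter. -/
def MemLipschitz (ω : ℝ≥0 → ℝ≥0) (Ω : Set ℂ) (f : ℂ → ℂ) : Prop :=
  ∃ M : ℝ, 0 < M ∧ ∀ z₁ ∈ Ω, ∀ z₂ ∈ Ω, ‖f z₁ - f z₂‖ ≤ M * (ω ‖z₁ - z₂‖₊ : ℝ)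

/-- The open unit disk. -/
def unitDisk : Set ℂ := Metric.ball 0 1

/-- The unit circle. -/
def unitCircle : Set ℂ := Metric.sphere 0 1

/-- The formal derivative `∂f/∂z̄ = (∂f/∂x + i ∂f/∂y) / 2`. -/
noncomputable def dzbar (f : ℂ → ℂ) (z : ℂ) : ℂ :=
  (1 / 2 : ℂ) * (fderiv ℝ f z 1 + Complex.I * fderiv ℝ f z Complex.I)

/-- The function `h`, defined on the open unit disk, has the boundary values `b` on the unit
circle: `h z → b ζ` as `z → ζ` inside the disk, for every `ζ` on the circle. -/
def HasBoundaryValues (h b : ℂ → ℂ) : Prop :=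
  ∀ ζ ∈ unitCircle, Filter.Tendsto h (𝓝[unitDisk] ζ) (𝓝 (b ζ))

/-- The function `φ₁` on the unit circle with `φ₁(e^{it}) = φ(e^{it}) e^{-it}`. -/
noncomputable def phiOne (φ : ℂ → ℂ) (ζ : ℂ) : ℂ := φ ζ * conj ζ

theorem phiOne_exp (φ : ℂ → ℂ) (t : ℝ) :
    phiOne φ (Complex.exp (t * Complex.I)) =
      φ (Complex.exp (t * Complex.I)) * Complex.exp (-(t * Complex.I)) := by
  simp [phiOne, ← Complex.exp_conj]

/-! The gradient of `f` is bounded on the disk, so `f` is Lipschitz there, and every majorant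
dominates a positive multiple of `t` on `[0, 2]`. From `φ₁` only boundedness enters: it makes
`∂f/∂z̄` bounded near the circle.

For the gradient, write `f = w + (ρ² - |z|²) H₁ + H₀` on a disk of radius `ρ < 1`, as in Almansi's
theorem, with harmonic polynomials `H₀`, `H₁` and an error `w` that has bounded Laplacian and is
tiny on `|z| = ρ` (`exists_almansi_decomposition`). Barriers and the maximum principle bound the
gradient of `w`. The function `z̄ ∂H₀/∂z̄ - ρ² H₁` is harmonic, and near `|z| = ρ` it nearly equals
`z̄ ∂(f - w)/∂z̄`, so it is bounded inside.

Since `f` vanishes on the circle, `H₀` can be made as small as wished compared with the distance `d`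
from a given point `a` to the circle. Near `a` its gradient is then at most 1, so `H₁` is bounded
there. The interior estimate gives `|∇H₁| = O(1/d)`, which the factor `ρ² - |z|² = O(d)` absorbs
(`norm_fderiv_apply_le_of_biharmonic`). -/

open Laplacian InnerProductSpace Polynomial

/-! ### The Laplacian in coordinates, under isometries and on quadratics -/

section LaplacianCalculus

theorem laplacian_eq_fderiv_fderiv {F : Type*} [NormedAddCommGroup F] [NormedSpace ℝ F]
    (f : ℂ → F) (z : ℂ) :
    Δ f z = fderiv ℝ (fderiv ℝ f) z 1 1 + fderiv ℝ (fderiv ℝ f) z Complex.I Complex.I := by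
  rw [laplacian_eq_iteratedFDeriv_complexPlane]
  simp [iteratedFDeriv_two_apply]

theorem differentiableAt_fderiv_of_contDiffAt {F : Type*} [NormedAddCommGroup F] [NormedSpace ℝ F]
    {f : ℂ → F} {z : ℂ} (hf : ContDiffAt ℝ 2 f z) : DifferentiableAt ℝ (fderiv ℝ f) z :=
  (hf.fderiv_right (m := 1) (by norm_num)).differentiableAt (by norm_num)

theorem fderiv_fderiv_apply {F : Type*} [NormedAddCommGroup F] [NormedSpace ℝ F]
    {f : ℂ → F} {z : ℂ} (hf : ContDiffAt ℝ 2 f z) (v w : ℂ) :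
    fderiv ℝ (fun x => fderiv ℝ f x v) z w = fderiv ℝ (fderiv ℝ f) z w v := by
  rw [fderiv_clm_apply (differentiableAt_fderiv_of_contDiffAt hf) (differentiableAt_const v)]
  simp

theorem laplacian_eq_fderiv_apply {F : Type*} [NormedAddCommGroup F] [NormedSpace ℝ F]
    {f : ℂ → F} {z : ℂ} (hf : ContDiffAt ℝ 2 f z) :
    Δ f z = fderiv ℝ (fun x => fderiv ℝ f x 1) z 1 +
      fderiv ℝ (fun x => fderiv ℝ f x Complex.I) z Complex.I := by
  rw [fderiv_fderiv_apply hf, fderiv_fderiv_apply hf, laplacian_eq_fderiv_fderiv]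

/-- The Laplacian is the trace of the Hessian in any orthonormal basis, in particular in the image
under `L` of the standard one. It is applied to rotations and reflections. -/
theorem laplacian_comp_affine_isometry {F : Type*} [NormedAddCommGroup F] [NormedSpace ℝ F]
    (f : ℂ → F) (L : ℂ ≃ₗᵢ[ℝ] ℂ) (a z : ℂ) :
    Δ (fun x => f (a + L x)) z = Δ f (a + L z) := by
  rw [laplacian_eq_iteratedFDeriv_orthonormalBasis _ Complex.orthonormalBasisOneI,
    laplacian_eq_iteratedFDeriv_orthonormalBasis _ (Complex.orthonormalBasisOneI.map L)]
  have h : iteratedFDeriv ℝ 2 ((fun x => f (a + x)) ∘ L.toContinuousLinearEquiv) z =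
      (iteratedFDeriv ℝ 2 (fun x => f (a + x)) (L z)).compContinuousLinearMap
        fun _ => (L.toContinuousLinearEquiv : ℂ →L[ℝ] ℂ) := by
    simpa [iteratedFDerivWithin_univ] using
      L.toContinuousLinearEquiv.iteratedFDerivWithin_comp_right (fun x => f (a + x))
        uniqueDiffOn_univ (x := z) (Set.mem_univ _) 2
  have h2 : (fun x => f (a + L x)) = (fun x => f (a + x)) ∘ L.toContinuousLinearEquiv := rfl
  simp only [h2, h, iteratedFDeriv_comp_add_left]
  refine Finset.sum_congr rfl fun i _ => ?_
  rw [ContinuousMultilinearMap.compContinuousLinearMap_apply]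
  congr 1
  ext j
  fin_cases j <;> simp

theorem hasFDerivAt_quadratic (α β γ δ : ℝ) (z : ℂ) :
    HasFDerivAt (fun w : ℂ => α * w.re ^ 2 + β * w.im ^ 2 + γ * w.im + δ)
      ((2 * α * z.re) • Complex.reCLM + (2 * β * z.im + γ) • Complex.imCLM) z := by
  have h1 : HasFDerivAt (fun w : ℂ => w.re) Complex.reCLM z := Complex.reCLM.hasFDerivAt
  have h2 : HasFDerivAt (fun w : ℂ => w.im) Complex.imCLM z := Complex.imCLM.hasFDerivAt
  refine (((((h1.pow 2).const_mul α).add ((h2.pow 2).const_mul β)).add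
    (h2.const_mul γ)).add_const δ).congr_fderiv ?_
  ext
  simp
  ring

/-- These quadratics serve as all the comparison functions below. -/
theorem laplacian_quadratic (α β γ δ : ℝ) (z : ℂ) :
    Δ (fun w : ℂ => α * w.re ^ 2 + β * w.im ^ 2 + γ * w.im + δ) z = 2 * α + 2 * β := by
  rw [laplacian_eq_fderiv_fderiv]
  have h : fderiv ℝ (fun w : ℂ => α * w.re ^ 2 + β * w.im ^ 2 + γ * w.im + δ) =
      fun z => (2 * α * z.re) • Complex.reCLM + (2 * β * z.im + γ) • Complex.imCLM :=
    funext fun z => (hasFDerivAt_quadratic α β γ δ z).fderiv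
  rw [h]
  have h1 : HasFDerivAt (fun w : ℂ => w.re) Complex.reCLM z := Complex.reCLM.hasFDerivAt
  have h2 : HasFDerivAt (fun w : ℂ => w.im) Complex.imCLM z := Complex.imCLM.hasFDerivAt
  have h3 := ((h1.const_mul (2 * α)).smul_const Complex.reCLM).add
    (((h2.const_mul (2 * β)).add_const γ).smul_const Complex.imCLM)
  erw [h3.fderiv]
  simp

theorem contDiff_quadratic (α β γ δ : ℝ) :
    ContDiff ℝ 2 (fun w : ℂ => α * w.re ^ 2 + β * w.im ^ 2 + γ * w.im + δ) := by
  have h1 : ContDiff ℝ 2 (fun w : ℂ => w.re) := Complex.reCLM.contDiff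
  have h2 : ContDiff ℝ 2 (fun w : ℂ => w.im) := Complex.imCLM.contDiff
  fun_prop

end LaplacianCalculus

/-! ### The weak maximum principle -/

section MaximumPrinciple

/-- Were it positive, the second derivative test would make `x` a local minimum too, so `g` would be
locally constant. -/
theorem deriv_deriv_nonpos_of_isLocalMax {g : ℝ → ℝ} {x : ℝ} (h : IsLocalMax g x)
    (hg : ContinuousAt g x) : deriv (deriv g) x ≤ 0 := by
  by_contra! hpos
  have hmin := isLocalMin_of_deriv_deriv_pos hpos h.deriv_eq_zero hg
  have hc : g =ᶠ[𝓝 x] fun _ => g x := by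
    filter_upwards [h, hmin] with y h1 h2 using le_antisymm h1 h2
  have : deriv (deriv g) x = 0 := by
    rw [hc.deriv.deriv_eq]; simp
  linarith

theorem fderiv_fderiv_nonpos_of_isLocalMax {u : ℂ → ℝ} {z : ℂ} (hu : ContDiffAt ℝ 2 u z)
    (h : IsLocalMax u z) (v : ℂ) : fderiv ℝ (fderiv ℝ u) z v v ≤ 0 := by
  have hline : ∀ t : ℝ, HasDerivAt (fun t : ℝ => z + t * v) v t := fun t => by
    simpa using ((Complex.ofRealCLM.hasDerivAt (x := t)).mul_const v).const_add z
  have hcont : Continuous fun t : ℝ => z + t * v := by fun_prop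
  have ht : Filter.Tendsto (fun t : ℝ => z + t * v) (𝓝 0) (𝓝 z) := by
    simpa using hcont.tendsto 0
  have h0 : z + ((0 : ℝ) : ℂ) * v = z := by simp
  have hmax : IsLocalMax (fun t : ℝ => u (z + t * v)) 0 := by
    have := ht.eventually h
    filter_upwards [this] with t ht
    simpa using ht
  have hev : ∀ᶠ w in 𝓝 z, ContDiffAt ℝ 2 u w := hu.eventually (by simp)
  have hd : deriv (fun t : ℝ => u (z + t * v)) =ᶠ[𝓝 0] fun t : ℝ => fderiv ℝ u (z + t * v) v := by
    filter_upwards [ht.eventually hev] with t ht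
    exact ((ht.differentiableAt (by norm_num)).hasFDerivAt.comp_hasDerivAt t (hline t)).deriv
  have hd2 : deriv (deriv (fun t : ℝ => u (z + t * v))) 0 = fderiv ℝ (fderiv ℝ u) z v v := by
    rw [hd.deriv_eq]
    have h1 : HasFDerivAt (fderiv ℝ u) (fderiv ℝ (fderiv ℝ u) z) (z + ((0 : ℝ) : ℂ) * v) := by
      rw [h0]; exact (differentiableAt_fderiv_of_contDiffAt hu).hasFDerivAt
    have h2 := h1.comp_hasDerivAt (0 : ℝ) (hline 0)
    have h3 := h2.clm_apply (hasDerivAt_const (0 : ℝ) v)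
    simpa using h3.deriv
  rw [← hd2]
  refine deriv_deriv_nonpos_of_isLocalMax hmax ?_
  have : ContinuousAt u (z + ((0 : ℝ) : ℂ) * v) := by rw [h0]; exact hu.continuousAt
  exact ContinuousAt.comp (f := fun t : ℝ => z + t * v) this hcont.continuousAt

theorem laplacian_nonpos_of_isLocalMax {u : ℂ → ℝ} {z : ℂ} (hu : ContDiffAt ℝ 2 u z)
    (h : IsLocalMax u z) : Δ u z ≤ 0 := by
  rw [laplacian_eq_fderiv_fderiv]
  linarith [fderiv_fderiv_nonpos_of_isLocalMax hu h 1,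
    fderiv_fderiv_nonpos_of_isLocalMax hu h Complex.I]

/-- The weak maximum principle for subharmonic functions. -/
theorem nonpos_of_laplacian_nonneg {K : Set ℂ} (hK : IsCompact K) {u : ℂ → ℝ}
    (hc : ContinuousOn u K) (hu : ∀ z ∈ interior K, ContDiffAt ℝ 2 u z)
    (hΔ : ∀ z ∈ interior K, 0 ≤ Δ u z) (hb : ∀ z ∈ K, z ∉ interior K → u z ≤ 0) :
    ∀ z ∈ K, u z ≤ 0 := by
  obtain ⟨R, hR⟩ := hK.isBounded.exists_norm_le
  have key : ∀ ε : ℝ, 0 < ε → ∀ z ∈ K, u z ≤ ε * R ^ 2 := by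
    intro ε hε z hz
    -- Adding `ε |w|²` makes the Laplacian strictly positive, which excludes an interior maximum;
    -- `ε` tends to 0 at the end.
    set q : ℂ → ℝ := fun w => ε * w.re ^ 2 + ε * w.im ^ 2 + 0 * w.im + 0 with hq
    have hqn : ∀ w, q w = ε * ‖w‖ ^ 2 := fun w => by
      rw [← Complex.normSq_eq_norm_sq, Complex.normSq_apply]; simp only [hq]; ring
    have hqc : ContDiff ℝ 2 q := contDiff_quadratic ..
    obtain ⟨m, hm, hmax⟩ := hK.exists_isMaxOn ⟨z, hz⟩ (hc.add hqc.continuous.continuousOn)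
    have h1 : u z + q z ≤ u m + q m := hmax hz
    have hqz : 0 ≤ q z := by rw [hqn]; positivity
    have hqm : q m ≤ ε * R ^ 2 := by
      rw [hqn]; have := hR m hm; gcongr
    by_cases hmi : m ∈ interior K
    · exfalso
      have hloc : IsLocalMax (u + q) m := by
        filter_upwards [isOpen_interior.mem_nhds hmi] with w hw
        exact hmax (interior_subset hw)
      have h2 := laplacian_nonpos_of_isLocalMax ((hu m hmi).add hqc.contDiffAt) hloc
      have h3 : Δ (u + q) m = Δ u m + (2 * ε + 2 * ε) := by
        rw [(hu m hmi).laplacian_add hqc.contDiffAt, laplacian_quadratic]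
      have h4 : Δ (u + q) m ≤ 0 := h2
      linarith [hΔ m hmi]
    · linarith [hb m hm hmi]
  intro z hz
  have hlim : Filter.Tendsto (fun ε : ℝ => ε * R ^ 2) (𝓝[>] 0) (𝓝 0) := by
    have : Continuous fun ε : ℝ => ε * R ^ 2 := by fun_prop
    simpa using (this.tendsto 0).mono_left nhdsWithin_le_nhds
  exact ge_of_tendsto hlim (by filter_upwards [self_mem_nhdsWithin] with ε hε using key ε hε z hz)

end MaximumPrinciple

/-! ### Interior estimates for Poisson's equation by barriers -/

section InteriorEstimates

/-- Reduces complex-valued functions to real ones, to which the maximum principle applies. -/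
theorem exists_real_functional_eq_norm (w : ℂ) :
    ∃ l : ℂ →L[ℝ] ℝ, l w = ‖w‖ ∧ ∀ x, |l x| ≤ ‖x‖ := by
  obtain ⟨l, hl, hw⟩ := exists_dual_vector'' ℝ w
  exact ⟨l, by simpa using hw, fun x => by simpa using l.le_of_opNorm_le hl x⟩

/-- The right-hand side has Laplacian `-N` and equals `M` on the circle, so it dominates every real
functional of norm at most 1 applied to `F`. -/
theorem norm_le_of_norm_laplacian_le {F : ℂ → ℂ} {R M N : ℝ} (hR : 0 < R)
    (hF : ∀ z ∈ Metric.closedBall (0 : ℂ) R, ContDiffAt ℝ 2 F z)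
    (hN : ∀ z ∈ Metric.ball (0 : ℂ) R, ‖Δ F z‖ ≤ N)
    (hM : ∀ z ∈ Metric.sphere (0 : ℂ) R, ‖F z‖ ≤ M) {z : ℂ} (hz : z ∈ Metric.closedBall (0 : ℂ) R) :
    ‖F z‖ ≤ M + N / 4 * (R ^ 2 - ‖z‖ ^ 2) := by
  obtain ⟨l, hl, hl1⟩ := exists_real_functional_eq_norm (F z)
  set q : ℂ → ℝ := fun w =>
    N / 4 * w.re ^ 2 + N / 4 * w.im ^ 2 + 0 * w.im + (-M - N / 4 * R ^ 2) with hq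
  have hqn : ∀ w, q w = N / 4 * (‖w‖ ^ 2 - R ^ 2) - M := fun w => by
    rw [← Complex.normSq_eq_norm_sq, Complex.normSq_apply]; simp only [hq]; ring
  have hqc : ContDiff ℝ 2 q := contDiff_quadratic ..
  have hlF : ∀ w ∈ Metric.closedBall (0 : ℂ) R, ContDiffAt ℝ 2 (l ∘ F) w := fun w hw =>
    l.contDiff.contDiffAt.comp w (hF w hw)
  have key := nonpos_of_laplacian_nonneg (isCompact_closedBall (0 : ℂ) R) (u := (l ∘ F) + q)
    (fun w hw => ((hlF w hw).continuousAt.add hqc.continuous.continuousAt).continuousWithinAt)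
    (fun w hw => (hlF w (interior_subset hw)).add hqc.contDiffAt) (fun w hw => ?_)
    (fun w hw hwi => ?_) z hz
  · simp only [Pi.add_apply, Function.comp_apply, hl, hqn] at key
    linarith
  · have hwc := interior_subset hw
    rw [interior_closedBall _ hR.ne'] at hw
    rw [(hlF w hwc).laplacian_add hqc.contDiffAt, laplacian_quadratic,
      (hF w hwc).laplacian_CLM_comp_left, Function.comp_apply]
    linarith [neg_abs_le (l (Δ F w)), hl1 (Δ F w), hN w hw]
  · rw [interior_closedBall _ hR.ne'] at hwi
    have hw' : ‖w‖ = R := by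
      simp only [mem_closedBall_zero_iff, mem_ball_zero_iff, not_lt] at hw hwi
      exact le_antisymm hw hwi
    simp only [Pi.add_apply, Function.comp_apply, hqn, hw']
    linarith [le_abs_self (l (F w)), hl1 (F w), hM w (by simpa using hw')]

theorem le_of_hasDerivAt_of_le_mul {η : ℝ → ℝ} {η' C d : ℝ} (hd : 0 < d) (h : HasDerivAt η η' 0)
    (h0 : η 0 = 0) (hle : ∀ t, 0 < t → t ≤ d → η t ≤ C * t) : η' ≤ C := by
  have h1 := (hasDerivAt_iff_tendsto_slope.1 h).mono_left
    (nhdsWithin_mono (0 : ℝ) (fun t (ht : 0 < t) => ht.ne') : 𝓝[>] (0 : ℝ) ≤ 𝓝[≠] 0)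
  refine le_of_tendsto h1 ?_
  filter_upwards [Ioc_mem_nhdsGT hd] with t ht
  rw [slope_def_field, h0, sub_zero, sub_zero, div_le_iff₀ ht.1]
  exact hle t ht.1 ht.2

/-- The interior gradient estimate for Poisson's equation. -/
theorem norm_fderiv_apply_le_of_norm_laplacian_le {F : ℂ → ℂ} {a v : ℂ} {d M N : ℝ} (hd : 0 < d)
    (hF : ∀ z ∈ Metric.closedBall a d, ContDiffAt ℝ 2 F z)
    (hN : ∀ z ∈ Metric.closedBall a d, ‖Δ F z‖ ≤ N)
    (hM : ∀ z ∈ Metric.closedBall a d, ‖F z‖ ≤ M) (hv : ‖v‖ = 1) :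
    ‖fderiv ℝ F a v‖ ≤ 2 * M / d + N * d / 2 := by
  have haa : a ∈ Metric.closedBall a d := Metric.mem_closedBall_self hd.le
  have hM0 : 0 ≤ M := (norm_nonneg _).trans (hM a haa)
  have hN0 : 0 ≤ N := (norm_nonneg _).trans (hN a haa)
  obtain ⟨l, hl, hl1⟩ := exists_real_functional_eq_norm (fderiv ℝ F a v)
  -- The rotation by `c` takes `I` to `v`, and `L₂` is `L₁` after conjugation. Hence `D` below
  -- vanishes on the real axis, and `D (t I) = F (a + t v) - F (a - t v)`.
  let c : Circle := ⟨-Complex.I * v, by simp [Submonoid.unitSphere, hv]⟩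
  have hc : (c : ℂ) = -Complex.I * v := rfl
  let L₁ : ℂ ≃ₗᵢ[ℝ] ℂ := rotation c
  let L₂ : ℂ ≃ₗᵢ[ℝ] ℂ := Complex.conjLIE.trans (rotation c)
  have hL₁ : ∀ z, L₁ z = c * z := fun z => rotation_apply c z
  have hL₂ : ∀ z, L₂ z = c * conj z := fun z => by simp [L₂]
  have hmem : ∀ (L : ℂ ≃ₗᵢ[ℝ] ℂ) {z : ℂ}, ‖z‖ ≤ d → a + L z ∈ Metric.closedBall a d := by
    intro L z hz
    simpa using hz
  have hLc : ∀ (L : ℂ ≃ₗᵢ[ℝ] ℂ) {z : ℂ}, ‖z‖ ≤ d → ContDiffAt ℝ 2 (fun x => F (a + L x)) z :=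
    fun L z hz => (hF _ (hmem L hz)).comp z
      (contDiffAt_const.add L.toContinuousLinearEquiv.contDiff.contDiffAt)
  set D : ℂ → ℂ := (fun x => F (a + L₁ x)) - fun x => F (a + L₂ x) with hD
  have hDc : ∀ {z : ℂ}, ‖z‖ ≤ d → ContDiffAt ℝ 2 D z := fun hz => (hLc L₁ hz).sub (hLc L₂ hz)
  have hDΔ : ∀ {z : ℂ}, ‖z‖ ≤ d → ‖Δ D z‖ ≤ 2 * N := fun {z} hz => by
    rw [(hLc L₁ hz).laplacian_sub (hLc L₂ hz), laplacian_comp_affine_isometry,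
      laplacian_comp_affine_isometry]
    exact (norm_sub_le _ _).trans (by linarith [hN _ (hmem L₁ hz), hN _ (hmem L₂ hz)])
  have hDM : ∀ {z : ℂ}, ‖z‖ ≤ d → ‖D z‖ ≤ 2 * M := fun {z} hz =>
    (norm_sub_le _ _).trans (by linarith [hM _ (hmem L₁ hz), hM _ (hmem L₂ hz)])
  -- the barrier
  set q : ℂ → ℝ := fun w => (-2 * M / d ^ 2) * w.re ^ 2 + (2 * M / d ^ 2 + N) * w.im ^ 2 +
    (-(4 * M / d + N * d)) * w.im + 0 with hq
  have hqc : ContDiff ℝ 2 q := contDiff_quadratic ..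
  have hlD : ∀ {z : ℂ}, ‖z‖ ≤ d → ContDiffAt ℝ 2 (l ∘ D) z := fun hz =>
    l.contDiff.contDiffAt.comp _ (hDc hz)
  set K : Set ℂ := Metric.closedBall 0 d ∩ {z | 0 ≤ z.im} with hK
  have hKc : IsCompact K :=
    (isCompact_closedBall _ _).inter_right (isClosed_le continuous_const Complex.continuous_im)
  have hKd : ∀ {z}, z ∈ K → ‖z‖ ≤ d := fun hz => by simpa using hz.1
  -- On the upper half disk, `Δq = 2N` compensates `ΔD`. On the diameter `D = 0` and `q ≤ 0`; on the
  -- arc `q ≤ -2M`.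
  have key := nonpos_of_laplacian_nonneg hKc (u := (l ∘ D) + q)
    (fun w hw => ((hlD (hKd hw)).continuousAt.add hqc.continuous.continuousAt).continuousWithinAt)
    (fun w hw => (hlD (hKd (interior_subset hw))).add hqc.contDiffAt) (fun w hw => ?_)
    (fun w hw hwi => ?_)
  · have hη : ∀ t : ℝ, 0 < t → t ≤ d →
        l (F (a + t * v) - F (a - t * v)) ≤ (4 * M / d + N * d) * t := by
      intro t ht htd
      have h1 := key (t * Complex.I) ⟨by simpa [abs_of_pos ht] using htd, by simpa using ht.le⟩
      have e1 : L₁ (t * Complex.I) = t * v := by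
        rw [hL₁, hc]; linear_combination -(t * v) * Complex.I_mul_I
      have e2 : L₂ (t * Complex.I) = -(t * v) := by
        rw [hL₂, hc]; simp only [map_mul, Complex.conj_ofReal, Complex.conj_I]
        linear_combination (t * v) * Complex.I_mul_I
      simp only [Pi.add_apply, Function.comp_apply, hD, hq, Pi.sub_apply, e1, e2,
        ← sub_eq_add_neg] at h1
      simp at h1
      have : 0 ≤ (2 * M / d ^ 2 + N) * t ^ 2 := by positivity
      simp only [map_sub]
      linarith
    have hp : HasDerivAt (fun t : ℝ => a + t * v) v 0 := by
      simpa using ((Complex.ofRealCLM.hasDerivAt (x := 0)).mul_const v).const_add a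
    have hm : HasDerivAt (fun t : ℝ => a - t * v) (-v) 0 := by
      simpa using ((Complex.ofRealCLM.hasDerivAt (x := 0)).mul_const v).const_sub a
    have hFa : HasFDerivAt F (fderiv ℝ F a) a :=
      ((hF a haa).differentiableAt (by norm_num)).hasFDerivAt
    have h2 : HasDerivAt (fun t : ℝ => l (F (a + t * v) - F (a - t * v)))
        (l (fderiv ℝ F a v - fderiv ℝ F a (-v))) 0 := by
      refine l.hasFDerivAt.comp_hasDerivAt 0 (HasDerivAt.sub ?_ ?_)
      · exact HasFDerivAt.comp_hasDerivAt (f := fun t : ℝ => a + t * v) 0 (by simpa using hFa) hp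
      · exact HasFDerivAt.comp_hasDerivAt (f := fun t : ℝ => a - t * v) 0 (by simpa using hFa) hm
    have h3 := le_of_hasDerivAt_of_le_mul hd h2 (by simp) hη
    rw [map_neg, sub_neg_eq_add, map_add, hl] at h3
    -- The symmetric difference has derivative `2 F'(a) v`, hence the halving.
    have : 2 * M / d + N * d / 2 = (4 * M / d + N * d) / 2 := by ring
    linarith
  · have hwd := hKd (interior_subset hw)
    rw [(hlD hwd).laplacian_add hqc.contDiffAt, laplacian_quadratic,
      (hDc hwd).laplacian_CLM_comp_left, Function.comp_apply]
    have : 2 * (-2 * M / d ^ 2) + 2 * (2 * M / d ^ 2 + N) = 2 * N := by ring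
    linarith [neg_abs_le (l (Δ D w)), hl1 (Δ D w), hDΔ hwd]
  · have hwd := hKd hw
    have him : 0 ≤ w.im := hw.2
    have himd : w.im ≤ d := (le_abs_self _).trans ((Complex.abs_im_le_norm w).trans hwd)
    have hsplit : w.im = 0 ∨ ‖w‖ = d := by
      by_contra! h
      refine hwi (mem_interior.2 ⟨Metric.ball 0 d ∩ {z | 0 < z.im}, ?_, ?_, ?_⟩)
      · exact fun z hz => ⟨Metric.ball_subset_closedBall hz.1, (show 0 < z.im from hz.2).le⟩
      · exact Metric.isOpen_ball.inter (isOpen_lt continuous_const Complex.continuous_im)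
      · exact ⟨by simpa using lt_of_le_of_ne hwd h.2, lt_of_le_of_ne him (Ne.symm h.1)⟩
    simp only [Pi.add_apply, Function.comp_apply]
    rcases hsplit with h | h
    · have hw0 : D w = 0 := by
        have : conj w = w := Complex.conj_eq_iff_im.2 h
        simp [hD, hL₁, hL₂, this]
      rw [hw0, map_zero, hq]
      simp only [h]
      have : 0 ≤ 2 * M / d ^ 2 * w.re ^ 2 := by positivity
      have e : -2 * M / d ^ 2 * w.re ^ 2 = -(2 * M / d ^ 2 * w.re ^ 2) := by ring
      linarith
    · have hre : w.re ^ 2 = d ^ 2 - w.im ^ 2 := by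
        rw [← h, ← Complex.normSq_eq_norm_sq, Complex.normSq_apply]; ring
      have e : q w = -2 * M - (4 * M / d ^ 2 + N) * (w.im * (d - w.im)) := by
        simp only [hq, hre]; field_simp; ring
      have h1 : 0 ≤ (4 * M / d ^ 2 + N) * (w.im * (d - w.im)) :=
        mul_nonneg (by positivity) (mul_nonneg him (by linarith))
      rw [e]
      linarith [le_abs_self (l (D w)), hl1 (D w), hDM hwd]

end InteriorEstimates

/-! ### Harmonic and biharmonic polynomials -/

section HarmonicPolynomials

/-- The real-analytic function `z ↦ A z * conj (B z)` for complex polynomials `A`, `B`. -/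
noncomputable def mixedEval (A B : ℂ[X]) (z : ℂ) : ℂ := A.eval z * conj (B.eval z)

theorem hasFDerivAt_conj_eval (B : ℂ[X]) (z : ℂ) :
    HasFDerivAt (fun w => conj (B.eval w))
      ((Complex.conjCLE : ℂ →L[ℝ] ℂ).comp
        ((ContinuousLinearMap.toSpanSingleton ℂ (B.derivative.eval z)).restrictScalars ℝ)) z :=
  (Complex.conjCLE : ℂ →L[ℝ] ℂ).hasFDerivAt.comp z
    ((B.hasDerivAt z).hasFDerivAt.restrictScalars ℝ)

theorem contDiff_polynomial_eval (A : ℂ[X]) {n : WithTop ℕ∞} :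
    ContDiff ℝ n (fun z => A.eval z) := by
  simpa using (A.contDiff_aeval (𝕜 := ℂ) n).restrict_scalars ℝ

theorem contDiff_mixedEval (A B : ℂ[X]) {n : WithTop ℕ∞} : ContDiff ℝ n (mixedEval A B) :=
  (contDiff_polynomial_eval A).mul
    ((Complex.conjCLE : ℂ →L[ℝ] ℂ).contDiff.comp (contDiff_polynomial_eval B))

theorem fderiv_mixedEval (A B : ℂ[X]) (z v : ℂ) :
    fderiv ℝ (mixedEval A B) z v =
      v * mixedEval A.derivative B z + conj v * mixedEval A B.derivative z := by
  have h := ((A.hasDerivAt z).hasFDerivAt.restrictScalars ℝ).mul (hasFDerivAt_conj_eval B z)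
  have h2 : HasFDerivAt (mixedEval A B) _ z := h
  rw [h2.fderiv]
  simp [mixedEval]
  ring

/-- `Δ = 4 ∂_z ∂_z̄`, and each of the two derivatives acts on one factor only. -/
theorem laplacian_mixedEval (A B : ℂ[X]) (z : ℂ) :
    Δ (mixedEval A B) z = 4 * mixedEval A.derivative B.derivative z := by
  rw [laplacian_eq_fderiv_apply (contDiff_mixedEval A B).contDiffAt]
  have hd : ∀ A B : ℂ[X], DifferentiableAt ℝ (mixedEval A B) z := fun A B =>
    (contDiff_mixedEval A B (n := 1)).contDiffAt.differentiableAt (by norm_num)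
  have key : ∀ v : ℂ, fderiv ℝ (fun x => fderiv ℝ (mixedEval A B) x v) z v =
      v * (v * mixedEval A.derivative.derivative B z +
        conj v * mixedEval A.derivative B.derivative z) +
      conj v * (v * mixedEval A.derivative B.derivative z +
        conj v * mixedEval A B.derivative.derivative z) := by
    intro v
    have h := (((hd A.derivative B).hasFDerivAt.const_mul v).add
      ((hd A B.derivative).hasFDerivAt.const_mul (conj v))).fderiv
    have h2 : (fun x => fderiv ℝ (mixedEval A B) x v) =
        (fun x => v * mixedEval A.derivative B x) + fun x => conj v * mixedEval A B.derivative x :=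
      funext fun x => fderiv_mixedEval A B x v
    rw [h2, h]
    simp [fderiv_mixedEval]
  rw [key, key]
  simp only [map_one, Complex.conj_I]
  linear_combination (mixedEval A.derivative.derivative B z
    - 2 * mixedEval A.derivative B.derivative z
    + mixedEval A B.derivative.derivative z) * Complex.I_mul_I

/-- The harmonic polynomial `z ↦ P z + conj (Q z)`. -/
noncomputable def harmonicEval (P Q : ℂ[X]) (z : ℂ) : ℂ := P.eval z + conj (Q.eval z)

theorem harmonicEval_eq (P Q : ℂ[X]) : harmonicEval P Q = mixedEval P 1 + mixedEval 1 Q := by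
  ext z; simp [harmonicEval, mixedEval]

theorem contDiff_harmonicEval (P Q : ℂ[X]) {n : WithTop ℕ∞} : ContDiff ℝ n (harmonicEval P Q) := by
  rw [harmonicEval_eq]
  exact (contDiff_mixedEval P 1).add (contDiff_mixedEval 1 Q)

theorem continuous_harmonicEval (P Q : ℂ[X]) : Continuous (harmonicEval P Q) :=
  (contDiff_harmonicEval P Q (n := 0)).continuous

theorem differentiableAt_harmonicEval (P Q : ℂ[X]) (z : ℂ) :
    DifferentiableAt ℝ (harmonicEval P Q) z :=
  (contDiff_harmonicEval P Q (n := 1)).contDiffAt.differentiableAt (by norm_num)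

theorem fderiv_harmonicEval (P Q : ℂ[X]) (z v : ℂ) :
    fderiv ℝ (harmonicEval P Q) z v = v * P.derivative.eval z + conj (v * Q.derivative.eval z) := by
  have hd : ∀ A B : ℂ[X], DifferentiableAt ℝ (mixedEval A B) z := fun A B =>
    (contDiff_mixedEval A B (n := 1)).contDiffAt.differentiableAt (by norm_num)
  rw [harmonicEval_eq, fderiv_add (hd _ _) (hd _ _), add_apply,
    fderiv_mixedEval, fderiv_mixedEval]
  simp [mixedEval]

theorem laplacian_harmonicEval (P Q : ℂ[X]) (z : ℂ) : Δ (harmonicEval P Q) z = 0 := by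
  rw [harmonicEval_eq, (contDiff_mixedEval P 1).contDiffAt.laplacian_add
    (contDiff_mixedEval 1 Q).contDiffAt, laplacian_mixedEval, laplacian_mixedEval]
  simp [mixedEval]

theorem dzbar_harmonicEval (P Q : ℂ[X]) (z : ℂ) :
    dzbar (harmonicEval P Q) z = conj (Q.derivative.eval z) := by
  simp only [dzbar, fderiv_harmonicEval, map_mul, map_one, Complex.conj_I]
  linear_combination (1 / 2) * (P.derivative.eval z - conj (Q.derivative.eval z)) * Complex.I_mul_I

/-- The biharmonic polynomial `z ↦ (ρ ^ 2 - |z| ^ 2) * (P z + conj (Q z))`. -/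
noncomputable def biharmonicEval (ρ : ℝ) (P Q : ℂ[X]) (z : ℂ) : ℂ :=
  ((ρ ^ 2 : ℝ) - z * conj z) * harmonicEval P Q z

theorem biharmonicEval_eq_zero {ρ : ℝ} (P Q : ℂ[X]) {z : ℂ} (hz : ‖z‖ = ρ) :
    biharmonicEval ρ P Q z = 0 := by
  simp [biharmonicEval, Complex.mul_conj, Complex.normSq_eq_norm_sq, hz]

theorem biharmonicEval_eq (ρ : ℝ) (P Q : ℂ[X]) : biharmonicEval ρ P Q =
    harmonicEval (C ((ρ ^ 2 : ℝ) : ℂ) * P) (C ((ρ ^ 2 : ℝ) : ℂ) * Q) -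
      (mixedEval (X * P) X + mixedEval X (X * Q)) := by
  ext z
  simp [biharmonicEval, harmonicEval, mixedEval]
  ring

theorem contDiff_biharmonicEval (ρ : ℝ) (P Q : ℂ[X]) {n : WithTop ℕ∞} :
    ContDiff ℝ n (biharmonicEval ρ P Q) := by
  rw [biharmonicEval_eq]
  exact (contDiff_harmonicEval _ _).sub ((contDiff_mixedEval _ _).add (contDiff_mixedEval _ _))

/-- The `ρ²` part is harmonic, and `|z|² P = (z P) z̄` has mixed derivative `(z P)'`; likewise for
`conj Q`. -/
theorem laplacian_biharmonicEval (ρ : ℝ) (P Q : ℂ[X]) (z : ℂ) :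
    Δ (biharmonicEval ρ P Q) z =
      -4 * harmonicEval (derivative (X * P)) (derivative (X * Q)) z := by
  have hm : ContDiffAt ℝ 2 (mixedEval (X * P) X + mixedEval X (X * Q)) z :=
    ((contDiff_mixedEval _ _).add (contDiff_mixedEval _ _)).contDiffAt
  rw [biharmonicEval_eq, (contDiff_harmonicEval _ _).contDiffAt.laplacian_sub hm,
    (contDiff_mixedEval _ _).contDiffAt.laplacian_add (contDiff_mixedEval _ _).contDiffAt,
    laplacian_harmonicEval, laplacian_mixedEval, laplacian_mixedEval]
  simp only [derivative_X, mixedEval, harmonicEval, eval_one, map_one]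
  ring

theorem fderiv_biharmonicEval (ρ : ℝ) (P Q : ℂ[X]) (z v : ℂ) :
    fderiv ℝ (biharmonicEval ρ P Q) z v =
      ((ρ ^ 2 : ℝ) - z * conj z) * fderiv ℝ (harmonicEval P Q) z v -
        (v * conj z + conj v * z) * harmonicEval P Q z := by
  have hc : HasFDerivAt (fun w : ℂ => conj w) (Complex.conjCLE : ℂ →L[ℝ] ℂ) z :=
    (Complex.conjCLE : ℂ →L[ℝ] ℂ).hasFDerivAt
  have h := (((hasFDerivAt_id (𝕜 := ℝ) z).mul hc).const_sub ((ρ ^ 2 : ℝ) : ℂ)).mul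
    (differentiableAt_harmonicEval P Q z).hasFDerivAt
  have h2 : HasFDerivAt (biharmonicEval ρ P Q) _ z := h
  rw [h2.fderiv]
  simp
  ring

theorem dzbar_biharmonicEval (ρ : ℝ) (P Q : ℂ[X]) (z : ℂ) :
    dzbar (biharmonicEval ρ P Q) z =
      ((ρ ^ 2 : ℝ) - z * conj z) * dzbar (harmonicEval P Q) z - z * harmonicEval P Q z := by
  simp only [dzbar, fderiv_biharmonicEval, map_one, Complex.conj_I]
  linear_combination (1 / 2) * (z - conj z) * harmonicEval P Q z * Complex.I_mul_I

/-- `A ↦ (X A)'` multiplies the coefficient of `X ^ n` by `n + 1`, which is invertible. -/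
theorem exists_derivative_X_mul_eq (P : ℂ[X]) : ∃ A : ℂ[X], derivative (X * A) = P := by
  induction P using Polynomial.induction_on' with
  | add p q hp hq =>
    obtain ⟨A, rfl⟩ := hp
    obtain ⟨B, rfl⟩ := hq
    exact ⟨A + B, by rw [mul_add, derivative_add]⟩
  | monomial n a =>
    refine ⟨C (a / (n + 1)) * X ^ n, ?_⟩
    have hn : (n + 1 : ℂ) ≠ 0 := Nat.cast_add_one_ne_zero n
    have : X * (C (a / (n + 1)) * X ^ n) = C (a / (n + 1)) * X ^ (n + 1) := by ring
    rw [this, derivative_C_mul_X_pow, ← C_mul_X_pow_eq_monomial]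
    simp [div_mul_cancel₀ a hn]

/-- Every harmonic polynomial is the Laplacian of some `biharmonicEval`. -/
theorem exists_laplacian_biharmonicEval_eq (ρ : ℝ) (P Q : ℂ[X]) :
    ∃ A B : ℂ[X], ∀ z, Δ (biharmonicEval ρ A B) z = harmonicEval P Q z := by
  obtain ⟨A, hA⟩ := exists_derivative_X_mul_eq (C (-1 / 4) * P)
  obtain ⟨B, hB⟩ := exists_derivative_X_mul_eq (C (-1 / 4) * Q)
  refine ⟨A, B, fun z => ?_⟩
  rw [laplacian_biharmonicEval, hA, hB]
  have h4 : conj (4 : ℂ) = 4 := map_ofNat _ 4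
  simp [harmonicEval, h4]
  ring

/-- Harmonic polynomials are dense in the continuous functions on a circle. -/
theorem exists_harmonicEval_near {ρ δ : ℝ} (hρ : 0 < ρ) (hδ : 0 < δ) {u : ℂ → ℂ}
    (hu : ContinuousOn u (Metric.sphere 0 ρ)) :
    ∃ P Q : ℂ[X], ∀ z : ℂ, ‖z‖ = ρ → ‖u z - harmonicEval P Q z‖ ≤ δ := by
  have hcirc : Continuous fun t : UnitAddCircle => (ρ : ℂ) * (AddCircle.toCircle t : ℂ) := by
    have := AddCircle.continuous_toCircle (T := 1)
    fun_prop
  have hmem : ∀ t : UnitAddCircle, (ρ : ℂ) * (AddCircle.toCircle t : ℂ) ∈ Metric.sphere (0 : ℂ) ρ :=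
    fun t => by simp [abs_of_pos hρ, Circle.norm_coe]
  let U : C(UnitAddCircle, ℂ) :=
    ⟨fun t => u (ρ * AddCircle.toCircle t), hu.comp_continuous hcirc hmem⟩
  have hU : U ∈ (Submodule.span ℂ (Set.range (fourier (T := 1)))).topologicalClosure := by
    rw [span_fourier_closure_eq_top]; trivial
  rw [← SetLike.mem_coe, Submodule.topologicalClosure_coe, Metric.mem_closure_iff] at hU
  obtain ⟨T, hT, hUT⟩ := hU δ hδ
  have hrep : ∃ P Q : ℂ[X], ∀ t : UnitAddCircle,
      T t = harmonicEval P Q (ρ * AddCircle.toCircle t) := by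
    have hρ0 : (ρ : ℂ) ≠ 0 := by exact_mod_cast hρ.ne'
    have hpow : ∀ (w : ℂ) (m : ℕ), ((ρ : ℂ) ^ m)⁻¹ * (ρ * w) ^ m = w ^ m := fun w m => by
      rw [mul_pow, inv_mul_cancel_left₀ (pow_ne_zero m hρ0)]
    refine Submodule.span_induction (p := fun T _ => ∃ P Q : ℂ[X], ∀ t : UnitAddCircle,
      T t = harmonicEval P Q (ρ * AddCircle.toCircle t)) ?_ ?_ ?_ ?_ hT
    -- On `|z| = ρ`, the Fourier mode of index `m ≥ 0` is `(z / ρ) ^ m`, and that of index `-m` is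
    -- its conjugate.
    · rintro _ ⟨n, rfl⟩
      obtain ⟨m, rfl | rfl⟩ := n.eq_nat_or_neg
      · refine ⟨C ((ρ : ℂ)⁻¹ ^ m) * X ^ m, 0, fun t => ?_⟩
        simp [harmonicEval, hpow, fourier_apply, AddCircle.toCircle_nsmul]
      · refine ⟨0, C ((ρ : ℂ)⁻¹ ^ m) * X ^ m, fun t => ?_⟩
        simp [harmonicEval, hpow, fourier_apply, AddCircle.toCircle_nsmul,
          AddCircle.toCircle_neg, ← Circle.coe_inv_eq_conj]
    · exact ⟨0, 0, fun t => by simp [harmonicEval]⟩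
    · rintro x y - - ⟨P, Q, h⟩ ⟨P', Q', h'⟩
      refine ⟨P + P', Q + Q', fun t => ?_⟩
      rw [ContinuousMap.add_apply, h, h']
      simp [harmonicEval]; ring
    · rintro a x - ⟨P, Q, h⟩
      refine ⟨C a * P, C (conj a) * Q, fun t => ?_⟩
      rw [ContinuousMap.smul_apply, h]
      simp [harmonicEval]; ring
  obtain ⟨P, Q, hPQ⟩ := hrep
  refine ⟨P, Q, fun z hz => ?_⟩
  have hz1 : ‖z / ρ‖ = 1 := by
    rw [norm_div, hz, Complex.norm_real, Real.norm_of_nonneg hρ.le, div_self hρ.ne']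
  obtain ⟨t, ht⟩ := (AddCircle.homeomorphCircle (T := 1) one_ne_zero).surjective
    ⟨z / ρ, by simpa [Submonoid.unitSphere] using hz1⟩
  have hzt : (ρ : ℂ) * AddCircle.toCircle t = z := by
    rw [AddCircle.homeomorphCircle_apply] at ht
    rw [ht]
    have hρ0 : (ρ : ℂ) ≠ 0 := by exact_mod_cast hρ.ne'
    exact mul_div_cancel₀ z hρ0
  have h1 := (ContinuousMap.dist_apply_le_dist t).trans hUT.le
  rwa [hPQ, hzt, dist_eq_norm, show U t = u z from congrArg u hzt] at h1

end HarmonicPolynomials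

/-! ### The operator `∂/∂z̄` -/

section FormalDerivative

theorem dzbar_add {f g : ℂ → ℂ} {z : ℂ} (hf : DifferentiableAt ℝ f z)
    (hg : DifferentiableAt ℝ g z) : dzbar (f + g) z = dzbar f z + dzbar g z := by
  simp only [dzbar, fderiv_add hf hg, add_apply]
  ring

theorem norm_dzbar_le {f : ℂ → ℂ} {z : ℂ} {W : ℝ}
    (h : ∀ v : ℂ, ‖v‖ = 1 → ‖fderiv ℝ f z v‖ ≤ W) : ‖dzbar f z‖ ≤ W := by
  have h1 := h 1 (by simp)
  have h2 := h Complex.I (by simp)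
  have h3 := norm_add_le (fderiv ℝ f z 1) (Complex.I * fderiv ℝ f z Complex.I)
  rw [norm_mul, Complex.norm_I, one_mul] at h3
  rw [dzbar, norm_mul]
  norm_num
  linarith

end FormalDerivative

/-! ### Almansi decomposition and the gradient bound -/

section GradientBound

theorem ContDiffAt.contDiffAt_laplacian {f : ℂ → ℂ} {z : ℂ} (hf : ContDiffAt ℝ 4 f z) :
    ContDiffAt ℝ 2 (Δ f) z := by
  have h : ContDiffAt ℝ 2 (fderiv ℝ (fderiv ℝ f)) z :=
    (hf.fderiv_right (m := 3) (by norm_num)).fderiv_right (m := 2) (by norm_num)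
  have e : Δ f = fun x => fderiv ℝ (fderiv ℝ f) x 1 1 +
      fderiv ℝ (fderiv ℝ f) x Complex.I Complex.I :=
    funext fun x => laplacian_eq_fderiv_fderiv f x
  rw [e]
  exact ((h.clm_apply contDiffAt_const).clm_apply contDiffAt_const).add
    ((h.clm_apply contDiffAt_const).clm_apply contDiffAt_const)

theorem norm_harmonicEval_le {P Q : ℂ[X]} {R M : ℝ} (hR : 0 < R)
    (hM : ∀ z : ℂ, ‖z‖ = R → ‖harmonicEval P Q z‖ ≤ M) {z : ℂ} (hz : ‖z‖ ≤ R) :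
    ‖harmonicEval P Q z‖ ≤ M := by
  have := norm_le_of_norm_laplacian_le (N := 0) hR
    (fun z _ => (contDiff_harmonicEval P Q).contDiffAt)
    (fun z _ => by rw [laplacian_harmonicEval, norm_zero])
    (fun z hz => hM z (by simpa using hz)) (z := z) (by simpa using hz)
  simpa using this

theorem norm_fderiv_harmonicEval_le {P Q : ℂ[X]} {a v : ℂ} {d M : ℝ} (hd : 0 < d)
    (hM : ∀ z ∈ Metric.closedBall a d, ‖harmonicEval P Q z‖ ≤ M) (hv : ‖v‖ = 1) :
    ‖fderiv ℝ (harmonicEval P Q) a v‖ ≤ 2 * M / d := by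
  have := norm_fderiv_apply_le_of_norm_laplacian_le (N := 0) hd
    (fun z _ => (contDiff_harmonicEval P Q).contDiffAt)
    (fun z _ => by rw [laplacian_harmonicEval, norm_zero]) hM hv
  simpa using this

/-- A function with bounded Laplacian which is small on a circle has bounded gradient inside. -/
theorem norm_fderiv_le_of_norm_le_on_sphere {w : ℂ → ℂ} {ρ r δ V : ℝ} (hρ : 0 < ρ) (hρ1 : ρ < 1)
    (hrρ : r < ρ) (hw : ∀ z : ℂ, ‖z‖ ≤ ρ → ContDiffAt ℝ 2 w z)
    (hV : ∀ z : ℂ, ‖z‖ ≤ ρ → ‖Δ w z‖ ≤ V) (hδ : δ ≤ ρ - r) (hwδ : ∀ z : ℂ, ‖z‖ = ρ → ‖w z‖ ≤ δ)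
    {z v : ℂ} (hz : ‖z‖ ≤ r) (hv : ‖v‖ = 1) : ‖fderiv ℝ w z v‖ ≤ 2 + 3 * V := by
  have hV0 : 0 ≤ V := (norm_nonneg _).trans (hV 0 (by simpa using hρ.le))
  have hd : 0 < ρ - ‖z‖ := by linarith
  set d := ρ - ‖z‖ with hd_def
  have hsub : ∀ y ∈ Metric.closedBall z d, ‖y‖ ≤ ρ ∧ ρ - 2 * d ≤ ‖y‖ := by
    intro y hy
    rw [mem_closedBall_iff_norm] at hy
    have h1 := norm_sub_norm_le y z
    have h2 := norm_sub_norm_le z y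
    rw [norm_sub_rev] at h2
    constructor <;> linarith
  -- A bound linear in `d` cancels the `1 / d` of the interior gradient estimate. It holds because
  -- `δ ≤ ρ - r ≤ d` and `ρ² - |y|² ≤ 4d`.
  have hwM : ∀ y ∈ Metric.closedBall z d, ‖w y‖ ≤ (1 + V) * d := by
    intro y hy
    obtain ⟨h1, h2⟩ := hsub y hy
    have h3 := norm_le_of_norm_laplacian_le hρ (fun z hz => hw z (by simpa using hz))
      (fun z hz => hV z (by simpa using (Metric.ball_subset_closedBall hz)))
      (fun z hz => hwδ z (by simpa using hz)) (z := y) (by simpa using h1)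
    have h4 : ρ ^ 2 - ‖y‖ ^ 2 ≤ 4 * d := by
      have : (ρ - ‖y‖) * (ρ + ‖y‖) ≤ (2 * d) * 2 :=
        mul_le_mul (by linarith) (by linarith) (by positivity) (by linarith)
      nlinarith
    have h5 : V / 4 * (ρ ^ 2 - ‖y‖ ^ 2) ≤ V / 4 * (4 * d) := by gcongr
    linarith
  have h := norm_fderiv_apply_le_of_norm_laplacian_le hd (fun y hy => hw y (hsub y hy).1)
    (fun y hy => hV y (hsub y hy).1) hwM hv
  have h6 : 2 * ((1 + V) * d) / d = 2 * (1 + V) := by field_simp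
  have h7 : V * d ≤ V * 1 := by
    gcongr
    linarith [norm_nonneg z]
  rw [h6] at h
  linarith

/-- An approximate Almansi decomposition of `f` on a disk of radius `ρ < 1`: `f` differs from
`(ρ ^ 2 - |z| ^ 2) * H₁ + H₀`, with `H₀` and `H₁` harmonic, by a function with bounded gradient. -/
theorem exists_almansi_decomposition {f : ℂ → ℂ} (hf : ContDiffOn ℝ 4 f unitDisk) {G B ε r ρ : ℝ}
    (hG : ∀ z ∈ unitDisk, ‖Δ (Δ f) z‖ ≤ G)
    (hB : ∀ z : ℂ, r ≤ ‖z‖ → ‖z‖ < 1 → ‖dzbar f z‖ ≤ B)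
    (hε : 0 < ε) (hfε : ∀ z : ℂ, r ≤ ‖z‖ → ‖z‖ < 1 → ‖f z‖ ≤ ε)
    (hr : 0 < r) (hrρ : r < ρ) (hρ1 : ρ < 1) :
    ∃ P₁ Q₁ P₀ Q₀ : ℂ[X],
      (∀ z v : ℂ, ‖z‖ ≤ r → ‖v‖ = 1 →
        ‖fderiv ℝ (f - (biharmonicEval ρ P₁ Q₁ + harmonicEval P₀ Q₀)) z v‖ ≤
          2 + 3 * (1 + G / 4)) ∧
      (∀ z : ℂ, ‖z‖ ≤ r → ‖conj z * dzbar (harmonicEval P₀ Q₀) z -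
        (ρ ^ 2 : ℝ) * harmonicEval P₁ Q₁ z‖ ≤ B + (2 + 3 * (1 + G / 4)) + 1) ∧
      ∀ z : ℂ, ‖z‖ ≤ ρ → ‖harmonicEval P₀ Q₀ z‖ ≤ 2 * ε := by
  have hρ : 0 < ρ := hr.trans hrρ
  have hG0 : 0 ≤ G := (norm_nonneg _).trans (hG 0 (by simp [unitDisk]))
  have hmem : ∀ {z : ℂ}, ‖z‖ ≤ ρ → z ∈ unitDisk := fun hz => by
    simpa [unitDisk] using hz.trans_lt hρ1
  have hf4 : ∀ {z : ℂ}, ‖z‖ ≤ ρ → ContDiffAt ℝ 4 f z := fun hz =>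
    hf.contDiffAt (Metric.isOpen_ball.mem_nhds (hmem hz))
  have hf2 : ∀ {z : ℂ}, ‖z‖ ≤ ρ → ContDiffAt ℝ 2 f z := fun hz => (hf4 hz).of_le (by norm_num)
  have hΔc : ∀ {z : ℂ}, ‖z‖ ≤ ρ → ContDiffAt ℝ 2 (Δ f) z := fun hz =>
    (hf4 hz).contDiffAt_laplacian
  -- `Δf` is within 1 of a harmonic polynomial on the circle, hence within `1 + G / 4` inside; `H₁`
  -- is chosen to produce that polynomial as a Laplacian.
  obtain ⟨PE, QE, hE⟩ := exists_harmonicEval_near hρ one_pos (u := Δ f) fun z hz =>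
    (hΔc (by simpa using (Metric.sphere_subset_closedBall hz))).continuousAt.continuousWithinAt
  obtain ⟨P₁, Q₁, h₁⟩ := exists_laplacian_biharmonicEval_eq ρ PE QE
  have hΔE : ∀ {z : ℂ}, ‖z‖ ≤ ρ → ‖Δ f z - harmonicEval PE QE z‖ ≤ 1 + G / 4 := by
    intro z hz
    have h := norm_le_of_norm_laplacian_le (F := Δ f - harmonicEval PE QE) (N := G) (M := 1) hρ
      (fun z hz => (hΔc (by simpa using hz)).sub (contDiff_harmonicEval PE QE).contDiffAt)
      (fun z hz => ?_) (fun z hz => hE z (by simpa using hz)) (z := z) (by simpa using hz)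
    · have h2 : G / 4 * (ρ ^ 2 - ‖z‖ ^ 2) ≤ G / 4 * 1 := by
        gcongr
        nlinarith [sq_nonneg ‖z‖]
      rw [Pi.sub_apply] at h
      linarith
    · have hz' : ‖z‖ ≤ ρ := by simpa using Metric.ball_subset_closedBall hz
      rw [(hΔc hz').laplacian_sub (contDiff_harmonicEval PE QE).contDiffAt,
        laplacian_harmonicEval, sub_zero]
      exact hG z (hmem hz')
  have hV0 : 0 ≤ 1 + G / 4 := by positivity
  generalize 1 + G / 4 = V at hΔE hV0 ⊢
  -- a circle on which the terms with a factor `ρ ^ 2 - |z| ^ 2` are small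
  obtain ⟨b, hb⟩ := (isCompact_closedBall (0 : ℂ) ρ).exists_bound_of_continuousOn
    (f := fun z => ‖harmonicEval P₁ Q₁ z‖ + ‖Q₁.derivative.eval z‖)
    (((continuous_harmonicEval P₁ Q₁).norm.add Q₁.derivative.continuous.norm).continuousOn)
  obtain ⟨s, hsρ, hrs, hs⟩ : ∃ s, s < ρ ∧ r < s ∧ (ρ ^ 2 - s ^ 2) * b < 1 := by
    have hc : Continuous fun s : ℝ => (ρ ^ 2 - s ^ 2) * b := by fun_prop
    have h1 : ∀ᶠ s in 𝓝[<] ρ, (ρ ^ 2 - s ^ 2) * b < 1 :=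
      ((hc.tendsto ρ).mono_left nhdsWithin_le_nhds).eventually_lt_const (by simp)
    obtain ⟨s, h2, h3⟩ := (h1.and (Ioo_mem_nhdsLT hrρ)).exists
    exact ⟨s, h3.2, h3.1, h2⟩
  have hs0 : 0 < s := hr.trans hrs
  -- The tolerance `ρ - s` serves the gradient bound for `w` on `|z| ≤ s`; the tolerance `ε` serves
  -- the bound `2ε` on `H₀`.
  obtain ⟨P₀, Q₀, h₀⟩ := exists_harmonicEval_near hρ (δ := min (ρ - s) ε)
    (lt_min (by linarith) hε) (u := f) fun z hz =>
    (hf2 (by simpa using (Metric.sphere_subset_closedBall hz))).continuousAt.continuousWithinAt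
  have hbh : ∀ z, ContDiffAt ℝ 2 (biharmonicEval ρ P₁ Q₁ + harmonicEval P₀ Q₀) z := fun z =>
    (contDiff_biharmonicEval ρ P₁ Q₁).contDiffAt.add (contDiff_harmonicEval P₀ Q₀).contDiffAt
  have hw : ∀ z v : ℂ, ‖z‖ ≤ s → ‖v‖ = 1 →
      ‖fderiv ℝ (f - (biharmonicEval ρ P₁ Q₁ + harmonicEval P₀ Q₀)) z v‖ ≤ 2 + 3 * V := by
    intro z v hz hv
    refine norm_fderiv_le_of_norm_le_on_sphere
      (w := f - (biharmonicEval ρ P₁ Q₁ + harmonicEval P₀ Q₀)) hρ hρ1 hsρ (fun z hz => (hf2 hz).sub (hbh z))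
      (fun z hz => ?_) (min_le_left _ ε) (fun z hz => ?_) hz hv
    · rw [(hf2 hz).laplacian_sub (hbh z), (contDiff_biharmonicEval ρ P₁ Q₁).contDiffAt.laplacian_add
        (contDiff_harmonicEval P₀ Q₀).contDiffAt, h₁, laplacian_harmonicEval, add_zero]
      exact hΔE hz
    · simpa [biharmonicEval_eq_zero P₁ Q₁ hz] using h₀ z hz
  refine ⟨P₁, Q₁, P₀, Q₀, fun z v hz hv => hw z v (hz.trans hrs.le) hv, fun z hz => ?_,
    fun z hz => ?_⟩
  -- Harmonic because `z̄ ∂H₀/∂z̄ = conj (z Q₀')`; so a bound on `|z| = s` suffices.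
  · have hharm : ∀ z, harmonicEval (-(C ((ρ ^ 2 : ℝ) : ℂ) * P₁))
        (X * Q₀.derivative - C ((ρ ^ 2 : ℝ) : ℂ) * Q₁) z =
        conj z * dzbar (harmonicEval P₀ Q₀) z - (ρ ^ 2 : ℝ) * harmonicEval P₁ Q₁ z := by
      intro z
      rw [dzbar_harmonicEval]
      simp [harmonicEval]
      ring
    rw [← hharm]
    refine norm_harmonicEval_le hs0 (fun z hz => ?_) (hz.trans hrs.le)
    rw [hharm]
    have hzρ : ‖z‖ ≤ ρ := hz.le.trans hsρ.le
    have hz1 : ‖z‖ ≤ 1 := hzρ.trans hρ1.le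
    have hsplit : dzbar f z = dzbar (f - (biharmonicEval ρ P₁ Q₁ + harmonicEval P₀ Q₀)) z +
        (dzbar (biharmonicEval ρ P₁ Q₁) z + dzbar (harmonicEval P₀ Q₀) z) := by
      have hd1 := ((contDiff_biharmonicEval ρ P₁ Q₁ (n := 1)).contDiffAt (x := z)).differentiableAt
        (by norm_num)
      have hd2 := differentiableAt_harmonicEval P₀ Q₀ z
      rw [← dzbar_add hd1 hd2, ← dzbar_add
        (((hf2 hzρ).differentiableAt (by norm_num)).sub (hd1.add hd2)) (hd1.add hd2),
        sub_add_cancel]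
    have hzz : z * conj z = ((s ^ 2 : ℝ) : ℂ) := by
      rw [Complex.mul_conj, Complex.normSq_eq_norm_sq, hz]
    have e : conj z * dzbar (harmonicEval P₀ Q₀) z - (ρ ^ 2 : ℝ) * harmonicEval P₁ Q₁ z =
        conj z * dzbar f z -
        conj z * dzbar (f - (biharmonicEval ρ P₁ Q₁ + harmonicEval P₀ Q₀)) z -
        ((ρ ^ 2 - s ^ 2 : ℝ) : ℂ) *
          (harmonicEval P₁ Q₁ z + conj z * conj (Q₁.derivative.eval z)) := by
      rw [hsplit, dzbar_biharmonicEval, hzz, dzbar_harmonicEval P₁ Q₁]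
      push_cast at hzz ⊢
      linear_combination (harmonicEval P₁ Q₁ z) * hzz
    have n1 : ∀ x : ℂ, ‖conj z * x‖ ≤ ‖x‖ := fun x => by
      rw [norm_mul, RCLike.norm_conj]
      exact mul_le_of_le_one_left (norm_nonneg _) hz1
    have n2 : ‖((ρ ^ 2 - s ^ 2 : ℝ) : ℂ) *
        (harmonicEval P₁ Q₁ z + conj z * conj (Q₁.derivative.eval z))‖ ≤ 1 := by
      have hpos : 0 ≤ ρ ^ 2 - s ^ 2 := by nlinarith
      have hbz := hb z (by simpa using hzρ)
      rw [Real.norm_of_nonneg (by positivity)] at hbz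
      have n3 := n1 (conj (Q₁.derivative.eval z))
      rw [RCLike.norm_conj] at n3
      rw [norm_mul, Complex.norm_real, Real.norm_of_nonneg hpos]
      refine (mul_le_mul_of_nonneg_left ?_ hpos).trans hs.le
      exact (norm_add_le _ _).trans (by linarith)
    rw [e]
    have n4 := norm_dzbar_le fun v hv => hw z v hz.le hv
    have n5 := hB z (hrs.le.trans hz.ge) (hzρ.trans_lt hρ1)
    refine (norm_sub_le _ _).trans (add_le_add ((norm_sub_le _ _).trans ?_) n2)
    exact add_le_add ((n1 _).trans n5) ((n1 _).trans n4)
  · refine norm_harmonicEval_le hρ (fun z hz => ?_) hz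
    have h2 := (h₀ z hz).trans (min_le_right _ _)
    have h3 := hfε z (hrρ.le.trans hz.ge) (hz.trans_lt hρ1)
    rw [norm_sub_rev] at h2
    linarith [norm_sub_norm_le (harmonicEval P₀ Q₀ z) (f z)]

/-- The decomposition may depend on `a`, since its constants do not. Taking `ε = d / 8` makes the
gradient of `H₀` at most 1 near `a`. -/
theorem norm_fderiv_apply_le_of_biharmonic {f : ℂ → ℂ} (hf : ContDiffOn ℝ 4 f unitDisk) {G B : ℝ}
    (hG : ∀ z ∈ unitDisk, ‖Δ (Δ f) z‖ ≤ G)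
    (hB : ∃ r < 1, ∀ z : ℂ, r ≤ ‖z‖ → ‖z‖ < 1 → ‖dzbar f z‖ ≤ B)
    (hf0 : ∀ ε > 0, ∃ r < 1, ∀ z : ℂ, r ≤ ‖z‖ → ‖z‖ < 1 → ‖f z‖ ≤ ε)
    {a v : ℂ} (ha : a ∈ unitDisk) (hv : ‖v‖ = 1) :
    ‖fderiv ℝ f a v‖ ≤
      2 + 3 * (1 + G / 4) + 1 + 72 * (B + (2 + 3 * (1 + G / 4)) + 1 + 1) := by
  have ha1 : ‖a‖ < 1 := by simpa [unitDisk] using ha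
  have hd : 0 < 1 - ‖a‖ := by linarith
  set d := 1 - ‖a‖ with hd_def
  have hd1 : d ≤ 1 := by linarith [norm_nonneg a]
  obtain ⟨r₁, hr₁, hB⟩ := hB
  obtain ⟨r₂, hr₂, hfε⟩ := hf0 (d / 8) (by positivity)
  obtain ⟨r, hr, h1r, h2r, h3r, h4r⟩ : ∃ r < 1, r₁ ≤ r ∧ r₂ ≤ r ∧ 1 / 2 ≤ r ∧ 1 - 3 * d / 4 ≤ r :=
    ⟨max (max r₁ r₂) (max (1 / 2) (1 - 3 * d / 4)),
      max_lt (max_lt hr₁ hr₂) (max_lt (by norm_num) (by linarith)),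
      (le_max_left _ _).trans (le_max_left _ _), (le_max_right _ _).trans (le_max_left _ _),
      (le_max_left _ _).trans (le_max_right _ _), (le_max_right _ _).trans (le_max_right _ _)⟩
  obtain ⟨ρ, hρ1, hrρ, hdρ⟩ : ∃ ρ < 1, r < ρ ∧ 1 - d / 4 ≤ ρ :=
    ⟨max ((1 + r) / 2) (1 - d / 4), max_lt (by linarith) (by linarith),
      lt_max_of_lt_left (by linarith), le_max_right _ _⟩
  obtain ⟨P₁, Q₁, P₀, Q₀, hw, hH, hH₀⟩ := exists_almansi_decomposition hf hG
    (fun z hz => hB z (h1r.trans hz)) (by positivity : 0 < d / 8)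
    (fun z hz => hfε z (h2r.trans hz)) (by linarith) hrρ hρ1
  generalize 2 + 3 * (1 + G / 4) = W at hw hH ⊢
  have hK0 : 0 ≤ B + W + 1 := (norm_nonneg _).trans (hH 0 (by simp; linarith))
  generalize B + W + 1 = K at hH hK0 ⊢
  have hball : ∀ z ∈ Metric.closedBall a (d / 4), ‖z‖ ≤ 1 - 3 * d / 4 := fun z hz => by
    rw [mem_closedBall_iff_norm] at hz
    linarith [norm_sub_norm_le z a]
  have hgrad₀ : ∀ z ∈ Metric.closedBall a (d / 4), ∀ v : ℂ, ‖v‖ = 1 →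
      ‖fderiv ℝ (harmonicEval P₀ Q₀) z v‖ ≤ 1 := by
    intro z hz v hv
    -- The disk of radius `d / 2` about `z` lies in `|y| ≤ 1 - d / 4 ≤ ρ`, where `|H₀| ≤ 2ε = d /
    -- 4`.
    have h := norm_fderiv_harmonicEval_le (P := P₀) (Q := Q₀) (a := z) (d := d / 2)
      (by positivity) (fun y hy => hH₀ y ?_) hv
    · have e : 2 * (2 * (d / 8)) / (d / 2) = 1 := by field_simp; norm_num
      rwa [e] at h
    · rw [mem_closedBall_iff_norm] at hy
      linarith [norm_sub_norm_le y z, hball z hz]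
  have hH₁ : ∀ z ∈ Metric.closedBall a (d / 4), ‖harmonicEval P₁ Q₁ z‖ ≤ 4 * (K + 1) := by
    intro z hz
    have h1 := hH z ((hball z hz).trans h4r)
    have h2 := norm_dzbar_le (hgrad₀ z hz)
    have h3 : ‖conj z * dzbar (harmonicEval P₀ Q₀) z‖ ≤ 1 := by
      rw [norm_mul, RCLike.norm_conj]
      exact mul_le_one₀ (by linarith [hball z hz]) (norm_nonneg _) h2
    have h4 : ‖((ρ ^ 2 : ℝ) : ℂ) * harmonicEval P₁ Q₁ z‖ ≤ K + 1 := by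
      rw [norm_sub_rev] at h1
      linarith [norm_sub_norm_le (((ρ ^ 2 : ℝ) : ℂ) * harmonicEval P₁ Q₁ z)
        (conj z * dzbar (harmonicEval P₀ Q₀) z)]
    rw [norm_mul, Complex.norm_real, Real.norm_of_nonneg (sq_nonneg ρ)] at h4
    have h5 : (1 / 4 : ℝ) ≤ ρ ^ 2 := by nlinarith
    nlinarith [norm_nonneg (harmonicEval P₁ Q₁ z)]
  have haa : a ∈ Metric.closedBall a (d / 4) := Metric.mem_closedBall_self (by positivity)
  have hgrad₁ := norm_fderiv_harmonicEval_le (by positivity : 0 < d / 4) hH₁ hv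
  -- `72 = 64 + 8`: `ρ² - |a|² ≤ 2d` times the gradient bound `32 (K + 1) / d` for `H₁`, plus twice
  -- the bound `4 (K + 1)` for `H₁` itself.
  have hbih : ‖fderiv ℝ (biharmonicEval ρ P₁ Q₁) a v‖ ≤ 72 * (K + 1) := by
    rw [fderiv_biharmonicEval]
    have h1 : ‖((ρ ^ 2 : ℝ) : ℂ) - a * conj a‖ ≤ 2 * d := by
      rw [Complex.mul_conj, Complex.normSq_eq_norm_sq, ← Complex.ofReal_sub, Complex.norm_real,
        Real.norm_of_nonneg (by nlinarith [norm_nonneg a])]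
      nlinarith [norm_nonneg a]
    have h2 : ‖v * conj a + conj v * a‖ ≤ 2 := by
      refine (norm_add_le _ _).trans ?_
      rw [norm_mul, norm_mul, RCLike.norm_conj, RCLike.norm_conj, hv]
      linarith
    refine (norm_sub_le _ _).trans ?_
    rw [norm_mul, norm_mul]
    have h3 := mul_le_mul h1 hgrad₁ (norm_nonneg _) (by positivity)
    have h4 := mul_le_mul h2 (hH₁ a haa) (norm_nonneg _) (by positivity)
    have e : 2 * d * (2 * (4 * (K + 1)) / (d / 4)) = 64 * (K + 1) := by field_simp; norm_num
    rw [e] at h3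
    linarith
  have hfa : DifferentiableAt ℝ f a :=
    (hf.contDiffAt (Metric.isOpen_ball.mem_nhds ha)).differentiableAt (by norm_num)
  have hd1 := ((contDiff_biharmonicEval ρ P₁ Q₁ (n := 1)).contDiffAt (x := a)).differentiableAt
    (by norm_num)
  have hd2 := differentiableAt_harmonicEval P₀ Q₀ a
  have hwa := hw a v (by linarith) hv
  rw [fderiv_sub hfa (hd1.add hd2), fderiv_add hd1 hd2, sub_apply, add_apply] at hwa
  have h1 := norm_sub_norm_le (fderiv ℝ f a v)
    (fderiv ℝ (biharmonicEval ρ P₁ Q₁) a v + fderiv ℝ (harmonicEval P₀ Q₀) a v)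
  have h2 := norm_add_le (fderiv ℝ (biharmonicEval ρ P₁ Q₁) a v)
    (fderiv ℝ (harmonicEval P₀ Q₀) a v)
  linarith [hgrad₀ a haa v hv]

end GradientBound

/-! ### From boundary limits to annuli -/

section Boundary

/-- By compactness, a neighbourhood of the circle contains a uniform thickening of it; a point `z`
near the circle is compared with `z / |z|`. -/
theorem exists_annulus_of_eventually {p : ℂ → Prop}
    (h : ∀ ζ ∈ unitCircle, ∀ᶠ z in 𝓝[unitDisk] ζ, p z) :
    ∃ r < 1, ∀ z : ℂ, r ≤ ‖z‖ → ‖z‖ < 1 → p z := by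
  have hS : {z | z ∈ unitDisk → p z} ∈ 𝓝ˢ unitCircle :=
    mem_nhdsSet_iff_forall.2 fun ζ hζ => eventually_nhdsWithin_iff.1 (h ζ hζ)
  obtain ⟨U, hU, hTU, hUS⟩ := mem_nhdsSet_iff_exists.1 hS
  obtain ⟨δ, hδ, hδU⟩ := (isCompact_sphere (0 : ℂ) 1).exists_thickening_subset_open hU hTU
  refine ⟨max (1 - δ / 2) (1 / 2), max_lt (by linarith) (by norm_num), fun z hz hz1 => ?_⟩
  have hzδ := (le_max_left _ _).trans hz
  have hz0 : 0 < ‖z‖ := by linarith [(le_max_right _ _).trans hz]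
  refine hUS (hδU (Metric.mem_thickening_iff.2 ⟨(‖z‖⁻¹ : ℝ) • z, ?_, ?_⟩))
    (by simpa [unitDisk] using hz1)
  · rw [mem_sphere_zero_iff_norm, norm_smul, norm_inv, norm_norm, inv_mul_cancel₀ hz0.ne']
  · have e : z - (‖z‖⁻¹ : ℝ) • z = (1 - ‖z‖⁻¹ : ℝ) • z := by rw [sub_smul, one_smul]
    have hinv : 1 ≤ ‖z‖⁻¹ := (one_le_inv₀ hz0).2 hz1.le
    rw [dist_eq_norm, e, norm_smul, Real.norm_of_nonpos (by linarith), neg_sub, sub_mul,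
      inv_mul_cancel₀ hz0.ne']
    linarith

theorem exists_annulus_norm_le {h b : ℂ → ℂ} (hb : HasBoundaryValues h b) {B B' : ℝ}
    (hB : ∀ ζ ∈ unitCircle, ‖b ζ‖ ≤ B) (hBB' : B < B') :
    ∃ r < 1, ∀ z : ℂ, r ≤ ‖z‖ → ‖z‖ < 1 → ‖h z‖ ≤ B' :=
  exists_annulus_of_eventually fun ζ hζ =>
    ((hb ζ hζ).norm.eventually_lt_const ((hB ζ hζ).trans_lt hBB')).mono fun _ => le_of_lt

end Boundary

/-! ### Majorants and Lipschitz classes -/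

section Majorant

/-- Monotonicity of `ω t / t` gives `c = ω 2 / 2`, where 2 is the diameter of the disk; `ω 2 > 0`
because `ω` is not identically zero. -/
theorem IsMajorant.exists_mul_le {ω : ℝ≥0 → ℝ≥0} (hω : IsMajorant ω) :
    ∃ c : ℝ, 0 < c ∧ ∀ t : ℝ≥0, t ≤ 2 → c * t ≤ ω t := by
  have h2 : 0 < ω 2 := by
    obtain ⟨s, hs⟩ := hω.exists_ne_zero
    have hs' : 0 < ω s := pos_iff_ne_zero.2 hs
    rcases le_total s 2 with h | h
    · exact hs'.trans_le (hω.monotone h)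
    · have hs0 : 0 < s := lt_of_lt_of_le two_pos h
      have h1 : ω s / s ≤ ω 2 / 2 := hω.antitoneOn_div (Set.mem_Ioi.2 two_pos) (Set.mem_Ioi.2 hs0) h
      have h3 : 0 < ω 2 / 2 := (div_pos hs' hs0).trans_le h1
      by_contra h4
      simp [nonpos_iff_eq_zero.1 (not_lt.1 h4)] at h3
  refine ⟨(ω 2 / 2 : ℝ≥0), by exact_mod_cast div_pos h2 two_pos, fun t ht => ?_⟩
  rcases eq_or_ne t 0 with rfl | h0
  · simp
  · have ht0 : 0 < t := pos_iff_ne_zero.2 h0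
    have h1 : ω 2 / 2 ≤ ω t / t := hω.antitoneOn_div (Set.mem_Ioi.2 ht0) (Set.mem_Ioi.2 two_pos) ht
    exact_mod_cast (le_div_iff₀ ht0).1 h1

/-- On the circle `|φ| = |φ₁|`, and `φ₁` oscillates by at most `M * ω 2`. -/
theorem exists_norm_le_of_memLipschitz_phiOne {ω : ℝ≥0 → ℝ≥0} (hω : IsMajorant ω) {φ : ℂ → ℂ}
    (hφ : MemLipschitz ω unitCircle (phiOne φ)) : ∃ B, ∀ ζ ∈ unitCircle, ‖φ ζ‖ ≤ B := by
  obtain ⟨M, hM, h⟩ := hφ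
  refine ⟨‖phiOne φ 1‖ + M * ω 2, fun ζ hζ => ?_⟩
  have hζ1 : ‖ζ‖ = 1 := by simpa [unitCircle] using hζ
  have h1 : (1 : ℂ) ∈ unitCircle := by simp [unitCircle]
  have hd : ‖ζ - 1‖₊ ≤ 2 := by
    have := norm_sub_le ζ 1
    rw [hζ1, norm_one] at this
    rw [← NNReal.coe_le_coe, coe_nnnorm]
    norm_num at this ⊢
    exact this
  have h2 := h ζ hζ 1 h1
  have h3 : (ω ‖ζ - 1‖₊ : ℝ) ≤ ω 2 := by exact_mod_cast hω.monotone hd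
  have h4 : ‖φ ζ‖ = ‖phiOne φ ζ‖ := by simp [phiOne, hζ1]
  rw [h4]
  have h5 := mul_le_mul_of_nonneg_left h3 hM.le
  linarith [norm_sub_norm_le (phiOne φ ζ) (phiOne φ 1)]

theorem memLipschitz_of_norm_fderiv_le {ω : ℝ≥0 → ℝ≥0} (hω : IsMajorant ω) {f : ℂ → ℂ}
    (hf : ∀ z ∈ unitDisk, DifferentiableAt ℝ f z) {C : ℝ}
    (hC : ∀ z ∈ unitDisk, ‖fderiv ℝ f z‖ ≤ C) : MemLipschitz ω unitDisk f := by
  obtain ⟨c, hc, hcω⟩ := hω.exists_mul_le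
  have hC0 : 0 ≤ C := (norm_nonneg _).trans (hC 0 (by simp [unitDisk]))
  refine ⟨(C + 1) / c, by positivity, fun z₁ h₁ z₂ h₂ => ?_⟩
  have h := (convex_ball (0 : ℂ) 1).norm_image_sub_le_of_norm_fderiv_le (𝕜 := ℝ) hf hC h₂ h₁
  have hd : ‖z₁ - z₂‖₊ ≤ 2 := by
    have h3 : ‖z₁‖ < 1 := by simpa [unitDisk] using h₁
    have h4 : ‖z₂‖ < 1 := by simpa [unitDisk] using h₂
    have h5 : ‖z₁ - z₂‖ ≤ 2 := (norm_sub_le _ _).trans (by linarith)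
    exact_mod_cast h5
  have h6 := hcω _ hd
  rw [coe_nnnorm] at h6
  calc ‖f z₁ - f z₂‖ ≤ (C + 1) * ‖z₁ - z₂‖ := by linarith [norm_nonneg (z₁ - z₂)]
    _ = (C + 1) / c * (c * ‖z₁ - z₂‖) := by field_simp
    _ ≤ (C + 1) / c * ω ‖z₁ - z₂‖₊ := by gcongr

end Majorant

/-! ### The main theorem -/

theorem corollary2 (ω : ℝ≥0 → ℝ≥0) (hω : IsMajorant ω)
    (g : ℂ → ℂ) (hg : ContinuousOn g (closure unitDisk))
    (φ : ℂ → ℂ) (hφ : MemLipschitz ω unitCircle (phiOne φ))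
    (f : ℂ → ℂ) (hf : ContDiffOn ℝ 4 f unitDisk)
    (hΔ : ∀ z ∈ unitDisk, Laplacian.laplacian (Laplacian.laplacian f) z = g z)
    (hφf : HasBoundaryValues (dzbar f) φ)
    (hf0 : HasBoundaryValues f (fun _ => 0)) :
    MemLipschitz ω unitDisk f := by
  obtain ⟨B, hB⟩ := exists_norm_le_of_memLipschitz_phiOne hω hφ
  have hcpt : IsCompact (closure unitDisk) := Metric.isBounded_ball.isCompact_closure
  obtain ⟨G, hG⟩ := hcpt.exists_bound_of_continuousOn hg
  have hG' : ∀ z ∈ unitDisk, ‖Laplacian.laplacian (Laplacian.laplacian f) z‖ ≤ G := fun z hz => by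
    rw [hΔ z hz]
    exact hG z (subset_closure hz)
  have hgrad := fun (a : ℂ) (ha : a ∈ unitDisk) (v : ℂ) (hv : ‖v‖ = 1) =>
    norm_fderiv_apply_le_of_biharmonic hf hG' (exists_annulus_norm_le hφf hB (lt_add_one B))
      (fun ε hε => exists_annulus_norm_le hf0 (B := 0) (fun ζ _ => by simp) hε) ha hv
  refine memLipschitz_of_norm_fderiv_le hω (fun z hz =>
    (hf.contDiffAt (Metric.isOpen_ball.mem_nhds hz)).differentiableAt (by norm_num))
    fun z hz => ContinuousLinearMap.opNorm_le_of_unit_norm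
      ((norm_nonneg _).trans (hgrad z hz 1 (by simp))) fun v hv => hgrad z hz v hv
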